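/- Let $R$ be a right Ore domain (a not necessarily commutative domain whose set $S=R\setminus\{0\}$ of regular elements is a right Ore set), let $Q$ be its classical right quotient ring, viewed as an overring of $R$, and let $K=Q/R$. The $R$-topology on $R_R$ has as a neighbourhood base of $0$ the right ideals $U(s_1,\dots,s_n)=\{x\in R\mid xR\subseteq Rs_1\cap\dots\cap Rs_n\}$ with $s_1,\dots,s_n\in S$. Let $\widetilde{R_R}=\varprojlim R/U(s_1,\dots,s_n)$ be the Hausdorff completion of $R_R$, and let $\eta\colon R\to\widetilde{R_R}$ be the canonical map. Give $\operatorname{End}(K_R)$ the right $R$-module structure $(fr)(k)=f(rk)$, and let $\lambda\colon R\to\operatorname{End}(K_R)$ be $\lambda(x)(k)=xk$. A right $R$-module $C$ is Matlis-cotorsion if $\operatorname{Ext}^1_R(Q_R,C)=0$, and a right $R$-module $M$ is strongly flat if $\operatorname{Ext}^1_R(M,C)=0$ for every Matlis-cotorsion right $R$-module $C$. Then: 1. $\widetilde{R_R}$ is a strongly flat right $R$-module. 2. If $R$ is not a division ring, then $\eta$ is injective, so that $R$ can be viewed as a submodule of $\widetilde{R_R}$. 3. There is an injective right $R$-module homomorphism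 $\widetilde\lambda\colon\widetilde{R_R}\to\operatorname{End}(K_R)$ with $\widetilde\lambda\circ\eta=\lambda$, given by $\widetilde\lambda(m)(rs^{-1}+R)=x\,rs^{-1}+R$ for all $m\in\widetilde{R_R}$, $r\in R$ and $s\in S$, where $x\in R$ is any representative of the component of $m$ in $R/U(s)$. 4. There are a set $X$ and an isomorphism of right $R$-modules $\widetilde{R_R}/\eta(R)\cong Q^{(X)}$. -/

import Mathlib

open scoped nonZeroDivisors

universe u

/-! Right `R`-modules are modules over the opposite ring `Rᵐᵒᵖ`: the element `x r` of a right
module is written `MulOpposite.op r • x`. On `R` itself this is right multiplication. -/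

/-- A right Ore domain: a domain whose regular (that is, non-zero) elements form a right Ore set,
i.e. for all `a` and all regular `s` one has `a t = s b` for some `b` and some regular `t`. -/
class IsRightOreDomain (R : Type*) [Ring R] : Prop extends IsDomain R where
  right_ore : ∀ (a : R) (s : R⁰), ∃ (b : R) (t : R⁰), a * (t : R) = (s : R) * b

/-! ### The classical right quotient ring `Q` and the bimodule `K = Q/R` -/

/-- The opposite ring of a right Ore domain is left Ore, with Mathlib's (left) convention. -/
theorem nonempty_oreSet_op (R : Type*) [Ring R] [IsRightOreDomain R] :
    Nonempty (OreLocalization.OreSet (Rᵐᵒᵖ)⁰) := by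
  rw [OreLocalization.nonempty_oreSet_iff_of_noZeroDivisors]
  intro r s
  have hs : (s : Rᵐᵒᵖ).unop ≠ 0 := by
    simp
  obtain ⟨b, t, h⟩ := IsRightOreDomain.right_ore r.unop ⟨_, mem_nonZeroDivisors_of_ne_zero hs⟩
  have ht : MulOpposite.op (t : R) ≠ 0 := by
    simp
  refine ⟨MulOpposite.op b, ⟨_, mem_nonZeroDivisors_of_ne_zero ht⟩, ?_⟩
  apply MulOpposite.unop_injective
  simpa using h

noncomputable instance instOreSetOp (R : Type*) [Ring R] [IsRightOreDomain R] :
    OreLocalization.OreSet (Rᵐᵒᵖ)⁰ :=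
  (nonempty_oreSet_op R).some

/-- The classical right quotient ring `Q` of a right Ore domain `R`. Mathlib's Ore localization
consists of left fractions, so we localize `Rᵐᵒᵖ` and pass to the opposite ring. -/
def RightQuot (R : Type*) [Ring R] [IsRightOreDomain R] : Type _ :=
  (OreLocalization (Rᵐᵒᵖ)⁰ Rᵐᵒᵖ)ᵐᵒᵖ

namespace RightQuot

variable (R : Type*) [Ring R] [IsRightOreDomain R]

noncomputable instance : DivisionRing (RightQuot R) :=
  inferInstanceAs (DivisionRing (OreLocalization (Rᵐᵒᵖ)⁰ Rᵐᵒᵖ)ᵐᵒᵖ)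

/-- The inclusion `R → Q`. -/
noncomputable def incl : R →+* RightQuot R :=
  ((OreLocalization.numeratorRingHom (R := Rᵐᵒᵖ) (S := (Rᵐᵒᵖ)⁰)).op).comp
    (RingEquiv.opOp R).toRingHom

/-- `Q` as a right `R`-module. -/
noncomputable instance : Module Rᵐᵒᵖ (RightQuot R) :=
  Module.compHom (RightQuot R) (incl R).op

theorem op_smul_def (r : R) (q : RightQuot R) : MulOpposite.op r • q = q * incl R r := rfl

theorem incl_injective : Function.Injective (incl R) := by
  intro a b h
  have h' : OreLocalization.numeratorHom (S := (Rᵐᵒᵖ)⁰) (MulOpposite.op a) =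
      OreLocalization.numeratorHom (MulOpposite.op b) := MulOpposite.op_injective h
  exact MulOpposite.op_injective (OreLocalization.numeratorHom_inj (S := (Rᵐᵒᵖ)⁰) inf_le_left h')

/-- Every element of `Q` is a right fraction `a s⁻¹`. -/
theorem exists_fraction (q : RightQuot R) :
    ∃ (a : R) (s : R⁰), q = incl R a * (incl R (s : R))⁻¹ := by
  obtain ⟨x, rfl⟩ : ∃ x, q = MulOpposite.op x := ⟨MulOpposite.unop q, rfl⟩
  induction x with | _ r s
  have hs : (s : Rᵐᵒᵖ).unop ≠ 0 := by
    simp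
  refine ⟨r.unop, ⟨_, mem_nonZeroDivisors_of_ne_zero hs⟩, ?_⟩
  have hs' : incl R (s : Rᵐᵒᵖ).unop ≠ 0 := by
    rw [Ne, map_eq_zero_iff _ (incl_injective R)]
    exact hs
  refine (eq_mul_inv_iff_mul_eq₀ hs').mpr ?_
  apply MulOpposite.unop_injective
  change OreLocalization.numeratorHom (s : Rᵐᵒᵖ) * (r /ₒ s) = OreLocalization.numeratorHom r
  rw [OreLocalization.numeratorHom_apply, OreLocalization.numeratorHom_apply]
  exact OreLocalization.mul_cancel

/-- The inclusion `R → Q` as a homomorphism of right `R`-modules. -/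
noncomputable def inclLinear : R →ₗ[Rᵐᵒᵖ] RightQuot R where
  toFun := incl R
  map_add' := map_add _
  map_smul' r x := by
    change incl R (x * r.unop) = incl R x * incl R r.unop
    exact map_mul _ _ _

/-- Left multiplication by `r` on `Q`, an endomorphism of `Q` as a right `R`-module. -/
noncomputable def mulLeftLinear (r : R) : RightQuot R →ₗ[Rᵐᵒᵖ] RightQuot R where
  toFun q := incl R r * q
  map_add' := mul_add _
  map_smul' a q := by
    change incl R r * (q * incl R a.unop) = incl R r * q * incl R a.unop
    exact (mul_assoc _ _ _).symm

end RightQuot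

/-- The right `R`-module `K = Q/R`. -/
abbrev QuotK (R : Type*) [Ring R] [IsRightOreDomain R] : Type _ :=
  RightQuot R ⧸ LinearMap.range (RightQuot.inclLinear R)

/-- The class `q + R` in `K = Q/R`. -/
noncomputable abbrev QuotK.mk {R : Type*} [Ring R] [IsRightOreDomain R] (q : RightQuot R) :
    QuotK R :=
  Submodule.Quotient.mk q

/-- The endomorphism ring `End(K_R)`. -/
abbrev EndK (R : Type*) [Ring R] [IsRightOreDomain R] : Type _ :=
  Module.End Rᵐᵒᵖ (QuotK R)

namespace EndK

variable (R : Type*) [Ring R] [IsRightOreDomain R]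

theorem range_le_comap (r : R) :
    LinearMap.range (RightQuot.inclLinear R) ≤
      (LinearMap.range (RightQuot.inclLinear R)).comap (RightQuot.mulLeftLinear R r) := by
  rintro _ ⟨x, rfl⟩
  exact ⟨r * x, map_mul (RightQuot.incl R) r x⟩

/-- The canonical ring homomorphism `R → End(K_R)`, sending `r` to left multiplication
`q + R ↦ r q + R` by `r`. -/
noncomputable def lam : R →+* EndK R where
  toFun r := Submodule.mapQ _ _ (RightQuot.mulLeftLinear R r) (range_le_comap R r)
  map_one' := by
    refine LinearMap.ext fun k => ?_
    induction k using Submodule.Quotient.induction_on with | _ q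
    refine congrArg QuotK.mk (?_ : RightQuot.incl R 1 * q = q)
    rw [map_one, one_mul]
  map_mul' a b := by
    refine LinearMap.ext fun k => ?_
    induction k using Submodule.Quotient.induction_on with | _ q
    refine congrArg QuotK.mk
      (?_ : RightQuot.incl R (a * b) * q = RightQuot.incl R a * (RightQuot.incl R b * q))
    rw [map_mul, mul_assoc]
  map_zero' := by
    refine LinearMap.ext fun k => ?_
    induction k using Submodule.Quotient.induction_on with | _ q
    refine congrArg QuotK.mk (?_ : RightQuot.incl R 0 * q = 0)
    rw [map_zero, zero_mul]
  map_add' a b := by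
    refine LinearMap.ext fun k => ?_
    induction k using Submodule.Quotient.induction_on with | _ q
    refine congrArg QuotK.mk
      (?_ : RightQuot.incl R (a + b) * q = RightQuot.incl R a * q + RightQuot.incl R b * q)
    rw [map_add, add_mul]

/-- The right `R`-module structure on `End(K_R)` given by `(f r)(k) = f (r k)`. -/
noncomputable instance instRightModule : Module Rᵐᵒᵖ (EndK R) :=
  Module.compHom (EndK R) (lam R).op

theorem op_smul_apply (r : R) (f : EndK R) (k : QuotK R) :
    (MulOpposite.op r • f) k = f (lam R r k) := rfl

theorem lam_mk (r : R) (q : RightQuot R) :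
    lam R r (QuotK.mk q) = QuotK.mk (RightQuot.incl R r * q) := rfl

end EndK

/-! ### The `R`-topology and its completion -/

section Completion

variable {R : Type*} [Ring R] (S : Submonoid R)
variable (M : Type*) [AddCommGroup M] [Module Rᵐᵒᵖ M]

/-- The submodule `U(s₁, …, sₙ) = {x ∈ M | x R ⊆ M s₁ ∩ … ∩ M sₙ}` of the right module `M`, for a
finite set `{s₁, …, sₙ} ⊆ S`. These are the basic neighbourhoods of `0` in the `R`-topology of
`M`. (The empty set contributes only `U(∅) = M`.) -/
def rNhd (F : Finset S) : Submodule Rᵐᵒᵖ M where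
  carrier := {x | ∀ r : R, ∀ s ∈ F, ∃ m : M, MulOpposite.op r • x = MulOpposite.op (s : R) • m}
  add_mem' := by
    intro x y hx hy r s hs
    obtain ⟨m, hm⟩ := hx r s hs
    obtain ⟨n, hn⟩ := hy r s hs
    exact ⟨m + n, by rw [smul_add, smul_add, hm, hn]⟩
  zero_mem' := fun r s _ => ⟨0, by rw [smul_zero, smul_zero]⟩
  smul_mem' := by
    intro a x hx r s hs
    obtain ⟨m, hm⟩ := hx (a.unop * r) s hs
    exact ⟨m, by rw [← hm, smul_smul, MulOpposite.op_mul, MulOpposite.op_unop]⟩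

/-- The submodule of compatible families in the product of all the quotients
`M / U(s₁, …, sₙ)`. -/
def compatibleFamilies : Submodule Rᵐᵒᵖ (∀ F : Finset S, M ⧸ rNhd S M F) where
  carrier := {m | ∀ (F G : Finset S) (h : rNhd S M G ≤ rNhd S M F),
    Submodule.factor h (m G) = m F}
  add_mem' := by
    intro x y hx hy F G h
    rw [Pi.add_apply, Pi.add_apply, map_add, hx F G h, hy F G h]
  zero_mem' := fun F G h => map_zero _
  smul_mem' := by
    intro a x hx F G h
    rw [Pi.smul_apply, Pi.smul_apply, map_smul, hx F G h]

/-- The Hausdorff completion of `M` in its `R`-topology: the inverse limit of the quotients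
`M / U(s₁, …, sₙ)` over the finite subsets of `S`, the submodules `U(s₁, …, sₙ)` being ordered by
inclusion. -/
def RCompletion : Type _ := compatibleFamilies S M

namespace RCompletion

instance : AddCommGroup (RCompletion S M) :=
  inferInstanceAs (AddCommGroup (compatibleFamilies S M))

instance : Module Rᵐᵒᵖ (RCompletion S M) :=
  inferInstanceAs (Module Rᵐᵒᵖ (compatibleFamilies S M))

/-- The canonical projection from the completion to `M / U(s₁, …, sₙ)`. -/
def proj (F : Finset S) : RCompletion S M →ₗ[Rᵐᵒᵖ] M ⧸ rNhd S M F :=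
  (LinearMap.proj F).comp (compatibleFamilies S M).subtype

/-- The canonical map `η` from `M` to its completion, with components `x + U(s₁, …, sₙ)`. -/
def eta : M →ₗ[Rᵐᵒᵖ] RCompletion S M :=
  LinearMap.codRestrict (compatibleFamilies S M)
    (LinearMap.pi fun F => (rNhd S M F).mkQ) fun _ _ _ _ => rfl

theorem proj_eta (F : Finset S) (x : M) :
    proj S M F (eta S M x) = (rNhd S M F).mkQ x := rfl

end RCompletion

end Completion

/-! ### Strongly flat modules -/

section StronglyFlat

open CategoryTheory

variable (R : Type u) [Ring R] [IsRightOreDomain R]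

/-- A right `R`-module `C` is Matlis-cotorsion if `Ext¹_R(Q_R, C) = 0`. -/
def IsMatlisCotorsion (C : ModuleCat.{u} Rᵐᵒᵖ) : Prop :=
  Subsingleton (Abelian.Ext (ModuleCat.of Rᵐᵒᵖ (RightQuot R)) C 1)

/-- A right `R`-module `M` is strongly flat if `Ext¹_R(M, C) = 0` for every Matlis-cotorsion right
`R`-module `C`. -/
def IsStronglyFlat (M : Type u) [AddCommGroup M] [Module Rᵐᵒᵖ M] : Prop :=
  ∀ C : ModuleCat.{u} Rᵐᵒᵖ, IsMatlisCotorsion R C →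
    Subsingleton (Abelian.Ext (ModuleCat.of Rᵐᵒᵖ M) C 1)

end StronglyFlat

/-! Since `x r ∈ R s` means `x r s⁻¹ ∈ R`, the ideal `U(s)` is the set of `x` whose left
multiplication kills every `r s⁻¹ + R` in `K`. Hence an element of the completion acts on `K`
through its representatives, and faithfully (`toEndK_injective`). The cokernel of `η` is
torsion-free: if `m s = η(x)`, then `m` acts as `x s⁻¹`, and applying it to `1 + R = 0` forces `x
s⁻¹ ∈ R`. It is divisible: representatives of `m` minus a constant are multiples of `s`, and
dividing them by `s` leaves a Cauchy net (`exists_smul_add_eta_eq`). So it is a `Q`-vector space,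
`Q⁽ˣ⁾`. If `R` is not a division ring, the completion is thus an extension of `Q⁽ˣ⁾` by the free
module `R`, hence strongly flat; otherwise it is zero. -/

/-! ### Vanishing of `Ext¹` -/

section Ext

open CategoryTheory

variable {A : Type u} [Ring A]

/-- For a projective presentation `0 → N → P → M → 0`, the group `Ext¹(M, C)` vanishes if and only
if every homomorphism `N → C` extends to `P`. -/
theorem subsingleton_ext_one_iff {N P M : Type u} [AddCommGroup N] [AddCommGroup P]
    [AddCommGroup M] [Module A N] [Module A P] [Module A M] [Module.Projective A P]
    (i : N →ₗ[A] P) (g : P →ₗ[A] M) (hi : Function.Injective i) (hg : Function.Surjective g)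
    (hig : Function.Exact i g) (C : ModuleCat.{u} A) :
    Subsingleton (Abelian.Ext (ModuleCat.of A M) C 1) ↔
      ∀ f : N →ₗ[A] C, ∃ h : P →ₗ[A] C, h ∘ₗ i = f := by
  have hS := ModuleCat.shortComplex_shortExact
    (ModuleCat.shortComplexOfCompEqZero i g hig.linearMap_comp_eq_zero) hig hi hg
  constructor
  · intro _ f
    obtain ⟨x, hx⟩ := Abelian.Ext.contravariant_sequence_exact₁ hS C
      (Abelian.Ext.mk₀ (ModuleCat.ofHom f)) (n₁ := 1) rfl (Subsingleton.elim _ _)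
    obtain ⟨h, rfl⟩ := Abelian.Ext.addEquiv₀.symm.surjective x
    refine ⟨h.hom, ?_⟩
    rw [Abelian.Ext.addEquiv₀_symm_apply, Abelian.Ext.mk₀_comp_mk₀] at hx
    exact congrArg ModuleCat.Hom.hom (Abelian.Ext.addEquiv₀.symm.injective hx)
  · intro H
    refine subsingleton_of_forall_eq 0 fun x => ?_
    have : Projective (ModuleCat.of A P) :=
      (IsProjective.iff_projective _).mp inferInstance
    obtain ⟨y, rfl⟩ := Abelian.Ext.contravariant_sequence_exact₃ hS C x
      (Abelian.Ext.eq_zero_of_projective (P := ModuleCat.of A P) _) (n₀ := 0) rfl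
    obtain ⟨f, rfl⟩ := Abelian.Ext.addEquiv₀.symm.surjective y
    obtain ⟨h, hh⟩ := H f.hom
    -- Every class is the extension class pushed out along some `f`; as `f` factors through `i`, and
    -- `i` kills the extension class, it is zero.
    have hf : f = ModuleCat.ofHom i ≫ ModuleCat.ofHom h := ModuleCat.hom_ext hh.symm
    rw [Abelian.Ext.addEquiv₀_symm_apply, hf, ← Abelian.Ext.mk₀_comp_mk₀]
    exact hS.extClass_comp_assoc _

/-- If `Ext¹(M, C) = 0`, then `Ext¹(M⁽ˣ⁾, C) = 0`, given a projective presentation of `M`. -/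
theorem subsingleton_ext_one_finsupp_of_presentation {N P M : Type u} [AddCommGroup N]
    [AddCommGroup P] [AddCommGroup M] [Module A N] [Module A P] [Module A M]
    [Module.Projective A P] (i : N →ₗ[A] P) (g : P →ₗ[A] M) (hi : Function.Injective i)
    (hg : Function.Surjective g) (hig : Function.Exact i g) (X : Type u) (C : ModuleCat.{u} A)
    (h : Subsingleton (Abelian.Ext (ModuleCat.of A M) C 1)) :
    Subsingleton (Abelian.Ext (ModuleCat.of A (X →₀ M)) C 1) := by
  classical
  rw [subsingleton_ext_one_iff i g hi hg hig] at h
  let i' : (X →₀ N) →ₗ[A] X →₀ P := Finsupp.mapRange.linearMap i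
  let g' : (X →₀ P) →ₗ[A] X →₀ M := Finsupp.mapRange.linearMap g
  have : Module.Projective A (X →₀ P) := .of_equiv (finsuppLequivDFinsupp A).symm
  rw [subsingleton_ext_one_iff i' g' (Finsupp.mapRange_injective _ (map_zero i) hi)
    (Finsupp.mapRange_surjective _ (map_zero g) hg)]
  · intro f
    choose φ hφ using fun x => h (f ∘ₗ Finsupp.lsingle x)
    refine ⟨Finsupp.lsum ℕ φ, Finsupp.lhom_ext' fun x => ?_⟩
    ext1 n
    simpa [i'] using LinearMap.congr_fun (hφ x) n
  · intro v
    constructor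
    · intro hv
      have hv' : ∀ x, ∃ n, i n = v x := fun x =>
        (hig (v x)).mp (by simpa [g'] using DFunLike.congr_fun hv x)
      choose n hn using hv'
      -- Injectivity of `i` makes the chosen preimages vanish off the support of `v`.
      refine ⟨Finsupp.onFinset v.support n fun x hx => ?_, ?_⟩
      · rw [Finsupp.mem_support_iff, ← hn]
        exact fun h0 => hx (hi (h0.trans (map_zero i).symm))
      · ext1 x
        simp [i', hn]
    · rintro ⟨w, rfl⟩
      ext x
      simp [i', g', hig.apply_apply_eq_zero]

/-- If `Ext¹(M, C) = 0`, then `Ext¹(M⁽ˣ⁾, C) = 0`. -/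
theorem subsingleton_ext_one_finsupp (M X : Type u) [AddCommGroup M] [Module A M]
    (C : ModuleCat.{u} A) (h : Subsingleton (Abelian.Ext (ModuleCat.of A M) C 1)) :
    Subsingleton (Abelian.Ext (ModuleCat.of A (X →₀ M)) C 1) := by
  let g : (M →₀ A) →ₗ[A] M := Finsupp.linearCombination A id
  exact subsingleton_ext_one_finsupp_of_presentation (N := LinearMap.ker g) (P := M →₀ A)
    (LinearMap.ker g).subtype g Subtype.val_injective
    (Finsupp.linearCombination_id_surjective A M) (LinearMap.exact_subtype_ker_map g) X C h

/-- In a short exact sequence `0 → N → M → M' → 0` with `N` projective, the vanishing of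
`Ext¹(M', C)` implies that of `Ext¹(M, C)`. -/
theorem subsingleton_ext_one_of_exact {N M M' : Type u} [AddCommGroup N] [AddCommGroup M]
    [AddCommGroup M'] [Module A N] [Module A M] [Module A M'] [Module.Projective A N]
    (i : N →ₗ[A] M) (g : M →ₗ[A] M') (hi : Function.Injective i) (hg : Function.Surjective g)
    (hig : Function.Exact i g) (C : ModuleCat.{u} A)
    (h : Subsingleton (Abelian.Ext (ModuleCat.of A M') C 1)) :
    Subsingleton (Abelian.Ext (ModuleCat.of A M) C 1) := by
  have hS := ModuleCat.shortComplex_shortExact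
    (ModuleCat.shortComplexOfCompEqZero i g hig.linearMap_comp_eq_zero) hig hi hg
  refine subsingleton_of_forall_eq 0 fun x => ?_
  have : Projective (ModuleCat.of A N) := (IsProjective.iff_projective _).mp inferInstance
  obtain ⟨y, rfl⟩ := Abelian.Ext.contravariant_sequence_exact₂ hS C x
    (Abelian.Ext.eq_zero_of_projective (P := ModuleCat.of A N) _)
  obtain rfl : y = 0 := Subsingleton.elim (α := Abelian.Ext (ModuleCat.of A M') C 1) _ _
  simp

end Ext

/-! ### Fractions in `Q` -/

namespace RightQuot

variable {R : Type*} [Ring R] [IsRightOreDomain R]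

theorem incl_ne_zero (s : R⁰) : incl R (s : R) ≠ 0 := by
  rw [Ne, map_eq_zero_iff _ (incl_injective R)]
  exact nonZeroDivisors.coe_ne_zero s

/-- A denominator of `q`. -/
noncomputable def den (q : RightQuot R) : R⁰ := (exists_fraction R q).choose_spec.choose

theorem exists_eq_div_den (q : RightQuot R) :
    ∃ a : R, q = incl R a * (incl R (den q : R))⁻¹ :=
  ⟨_, (exists_fraction R q).choose_spec.choose_spec⟩

end RightQuot

theorem QuotK.mk_eq_zero_iff {R : Type*} [Ring R] [IsRightOreDomain R] {q : RightQuot R} :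
    QuotK.mk q = 0 ↔ ∃ x, RightQuot.incl R x = q :=
  Submodule.Quotient.mk_eq_zero _

open RightQuot

/-! ### The `R`-topology on `R` and Cauchy nets -/

section

variable {R : Type*} [Ring R]

theorem mem_rNhd_iff {F : Finset R⁰} {x : R} :
    x ∈ rNhd R⁰ R F ↔ ∀ s ∈ F, ∀ r : R, ∃ m : R, x * r = m * s :=
  ⟨fun h s hs r => h r s hs, fun h r s hs => h s hs r⟩

theorem mem_rNhd_iff_singleton {F : Finset R⁰} {x : R} :
    x ∈ rNhd R⁰ R F ↔ ∀ s ∈ F, x ∈ rNhd R⁰ R {s} := by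
  simp [mem_rNhd_iff]

theorem rNhd_anti {F G : Finset R⁰} (h : F ⊆ G) : rNhd R⁰ R G ≤ rNhd R⁰ R F :=
  fun _ hx r s hs => hx r s (h hs)

/-- Each `R s` is a left ideal, so `U(F)` is two-sided; divisibility of the cokernel of `η` depends
on this. -/
theorem mul_mem_rNhd {F : Finset R⁰} {x : R} (a : R) (hx : x ∈ rNhd R⁰ R F) :
    a * x ∈ rNhd R⁰ R F := by
  rw [mem_rNhd_iff] at hx ⊢
  intro s hs r
  obtain ⟨m, hm⟩ := hx s hs r
  exact ⟨a * m, by rw [mul_assoc, hm, mul_assoc]⟩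

namespace RCompletion

theorem ext_proj {m m' : RCompletion R⁰ R} (h : ∀ F, proj R⁰ R F m = proj R⁰ R F m') : m = m' :=
  Subtype.ext (funext h)

theorem factor_proj (m : RCompletion R⁰ R) {F G : Finset R⁰} (h : rNhd R⁰ R G ≤ rNhd R⁰ R F) :
    Submodule.factor h (proj R⁰ R G m) = proj R⁰ R F m :=
  m.2 F G h

/-- A representative in `R` of the component of `m` in `R / U(F)`. -/
noncomputable def rep (m : RCompletion R⁰ R) (F : Finset R⁰) : R :=
  (Submodule.mkQ_surjective _ (proj R⁰ R F m)).choose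

theorem mkQ_rep (m : RCompletion R⁰ R) (F : Finset R⁰) :
    (rNhd R⁰ R F).mkQ (rep m F) = proj R⁰ R F m :=
  (Submodule.mkQ_surjective _ (proj R⁰ R F m)).choose_spec

theorem proj_eq_mkQ_rep (m : RCompletion R⁰ R) {F G : Finset R⁰}
    (h : rNhd R⁰ R G ≤ rNhd R⁰ R F) : proj R⁰ R F m = (rNhd R⁰ R F).mkQ (rep m G) := by
  rw [← factor_proj m h, ← mkQ_rep]
  rfl

theorem rep_sub_rep_mem (m : RCompletion R⁰ R) {F G : Finset R⁰} (h : F ⊆ G) :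
    rep m G - rep m F ∈ rNhd R⁰ R F := by
  rw [← Submodule.Quotient.eq]
  exact (proj_eq_mkQ_rep m (rNhd_anti h)).symm.trans (mkQ_rep m F).symm

/-- A Cauchy net `w` in `R`, indexed by the finite subsets of `R⁰`, defines an element of the
completion. -/
def ofCauchy (w : Finset R⁰ → R) (hw : ∀ F G, F ⊆ G → w G - w F ∈ rNhd R⁰ R F) :
    RCompletion R⁰ R := by
  classical
  exact ⟨fun F => (rNhd R⁰ R F).mkQ (w F), fun F G h => by
    refine (Submodule.Quotient.eq _).mpr ?_
    -- Compatibility is required whenever `U(G) ≤ U(F)`, even if `F ⊄ G`; both are compared with `F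
    -- ∪ G`.
    have h₁ := hw F (F ∪ G) Finset.subset_union_left
    have h₂ := h (hw G (F ∪ G) Finset.subset_union_right)
    simpa using sub_mem h₁ h₂⟩

theorem proj_ofCauchy (w : Finset R⁰ → R) (hw : ∀ F G, F ⊆ G → w G - w F ∈ rNhd R⁰ R F)
    (F : Finset R⁰) : proj R⁰ R F (ofCauchy w hw) = (rNhd R⁰ R F).mkQ (w F) := rfl

/-- The topology is discrete here, so the component at `s` determines all others. -/
theorem eta_surjective_of_rNhd_eq_bot {s : R⁰} (h : rNhd R⁰ R {s} = ⊥) :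
    Function.Surjective (eta R⁰ R) := by
  classical
  refine fun m => ⟨rep m {s}, ext_proj fun F => ?_⟩
  have hm := rep_sub_rep_mem m (Finset.singleton_subset_iff.mpr (Finset.mem_insert_self s F))
  rw [h, Submodule.mem_bot, sub_eq_zero] at hm
  rw [proj_eta, ← hm, ← proj_eq_mkQ_rep m (rNhd_anti (Finset.subset_insert s F))]

end RCompletion

end

open RCompletion

/-! ### When `η` is injective -/

variable {R : Type*} [Ring R] [IsRightOreDomain R]

theorem mem_rNhd_singleton_iff {s : R⁰} {x : R} :
    x ∈ rNhd R⁰ R {s} ↔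
      ∀ r : R, QuotK.mk (incl R x * (incl R r * (incl R (s : R))⁻¹)) = 0 := by
  simp only [mem_rNhd_iff, Finset.mem_singleton, forall_eq, QuotK.mk_eq_zero_iff]
  refine forall_congr' fun r => exists_congr fun m => ?_
  rw [← mul_assoc, eq_mul_inv_iff_mul_eq₀ (incl_ne_zero s), ← map_mul, ← map_mul,
    (incl_injective R).eq_iff, eq_comm]

/-- If `R` is not a division ring, then the `R`-topology is Hausdorff. -/
theorem eq_zero_of_forall_mem_rNhd (hR : ∃ a : R, a ≠ 0 ∧ ¬ IsUnit a) {x : R}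
    (hx : ∀ s, x ∈ rNhd R⁰ R {s}) : x = 0 := by
  by_contra hx0
  obtain ⟨a, ha, hau⟩ := hR
  have hxQ : incl R x ≠ 0 := incl_ne_zero ⟨x, mem_nonZeroDivisors_of_ne_zero hx0⟩
  have haQ : incl R a ≠ 0 := incl_ne_zero ⟨a, mem_nonZeroDivisors_of_ne_zero ha⟩
  -- If `x ≠ 0` lies in every `U(s)`, then `x Q ⊆ R`; but `x Q = Q`, so `R = Q`.
  have key : ∀ q : RightQuot R, ∃ y, incl R y = q := by
    intro q
    obtain ⟨b, s, h⟩ := exists_fraction R ((incl R x)⁻¹ * q)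
    obtain ⟨y, hy⟩ := QuotK.mk_eq_zero_iff.mp (mem_rNhd_singleton_iff.mp (hx s) b)
    exact ⟨y, by rw [hy, ← h, mul_inv_cancel_left₀ hxQ]⟩
  obtain ⟨y, hy⟩ := key (incl R a)⁻¹
  refine hau (isUnit_iff_exists.mpr ⟨y, incl_injective R ?_, incl_injective R ?_⟩)
  · rw [map_mul, hy, mul_inv_cancel₀ haQ, map_one]
  · rw [map_mul, hy, inv_mul_cancel₀ haQ, map_one]

theorem eta_injective (hR : ∃ a : R, a ≠ 0 ∧ ¬ IsUnit a) :
    Function.Injective (eta R⁰ R) := by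
  rw [injective_iff_map_eq_zero]
  refine fun x hx => eq_zero_of_forall_mem_rNhd hR fun s => ?_
  rw [← Submodule.Quotient.mk_eq_zero]
  exact congrArg (proj R⁰ R {s}) hx

theorem rNhd_eq_top_of_forall_isUnit (hR : ∀ a : R, a ≠ 0 → IsUnit a) (F : Finset R⁰) :
    rNhd R⁰ R F = ⊤ := by
  refine eq_top_iff.mpr fun x _ => mem_rNhd_iff.mpr fun s _ r => ?_
  obtain ⟨v, hv⟩ := hR s (nonZeroDivisors.coe_ne_zero s)
  exact ⟨x * r * ↑v⁻¹, by rw [← hv, Units.inv_mul_cancel_right]⟩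

theorem subsingleton_rCompletion (hR : ∀ a : R, a ≠ 0 → IsUnit a) :
    Subsingleton (RCompletion R⁰ R) := by
  refine ⟨fun m m' => ext_proj fun F => ?_⟩
  have : Subsingleton (R ⧸ rNhd R⁰ R F) :=
    Submodule.Quotient.subsingleton_iff.mpr (rNhd_eq_top_of_forall_isUnit hR F)
  exact Subsingleton.elim _ _

/-! ### The action of the completion on `K` -/

namespace RCompletion

/-- `x` represents `m` at the denominator of some fraction equal to `q`. -/
def Represents (m : RCompletion R⁰ R) (x : R) (q : RightQuot R) : Prop :=
  ∃ (a : R) (s : R⁰), q = incl R a * (incl R (s : R))⁻¹ ∧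
    proj R⁰ R {s} m = (rNhd R⁰ R {s}).mkQ x

theorem represents_rep (m : RCompletion R⁰ R) {F : Finset R⁰} {q : RightQuot R}
    (h : den q ∈ F) : Represents m (rep m F) q := by
  obtain ⟨a, ha⟩ := exists_eq_div_den q
  exact ⟨a, den q, ha, proj_eq_mkQ_rep m (rNhd_anti (by simpa using h))⟩

theorem mk_mul_eq_of_proj_eq {x y : R} {s : R⁰}
    (h : (rNhd R⁰ R {s}).mkQ x = (rNhd R⁰ R {s}).mkQ y) (a : R) :
    QuotK.mk (incl R x * (incl R a * (incl R (s : R))⁻¹)) =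
      QuotK.mk (incl R y * (incl R a * (incl R (s : R))⁻¹)) := by
  have := mem_rNhd_singleton_iff.mp ((Submodule.Quotient.eq _).mp h) a
  rwa [map_sub, sub_mul, QuotK.mk, Submodule.Quotient.mk_sub, sub_eq_zero] at this

theorem Represents.mk_mul_eq {m : RCompletion R⁰ R} {x x' : R} {q q' : RightQuot R}
    (h : Represents m x q) (h' : Represents m x' q') (hq : QuotK.mk q = QuotK.mk q') :
    QuotK.mk (incl R x * q) = QuotK.mk (incl R x' * q') := by
  classical
  obtain ⟨a, s, rfl, hs⟩ := h
  obtain ⟨a', s', rfl, hs'⟩ := h'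
  -- A representative at `{s, s'}` serves both fractions, and left multiplication by it is well
  -- defined on `K`.
  have h₁ := proj_eq_mkQ_rep m (rNhd_anti (show {s} ⊆ ({s, s'} : Finset R⁰) by simp))
  have h₂ := proj_eq_mkQ_rep m (rNhd_anti (show {s'} ⊆ ({s, s'} : Finset R⁰) by simp))
  rw [mk_mul_eq_of_proj_eq (hs.symm.trans h₁), mk_mul_eq_of_proj_eq (hs'.symm.trans h₂)]
  exact congrArg (EndK.lam R (rep m {s, s'})) hq

/-- The map `K → K` given by the action of `m`. -/
noncomputable def act (m : RCompletion R⁰ R) (k : QuotK R) : QuotK R :=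
  QuotK.mk (incl R (rep m {den (Quotient.out k)}) * Quotient.out k)

theorem act_mk {m : RCompletion R⁰ R} {x : R} {q : RightQuot R} (h : Represents m x q) :
    act m (QuotK.mk q) = QuotK.mk (incl R x * q) :=
  (represents_rep m (Finset.mem_singleton_self _)).mk_mul_eq h (Quotient.out_eq _)

theorem act_mk_of_mem (m : RCompletion R⁰ R) {F : Finset R⁰} {q : RightQuot R} (h : den q ∈ F) :
    act m (QuotK.mk q) = QuotK.mk (incl R (rep m F) * q) :=
  act_mk (represents_rep m h)

/-- The action of `m` on `K`, as an endomorphism of the right `R`-module `K`. -/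
noncomputable def actEnd (m : RCompletion R⁰ R) : EndK R where
  toFun := act m
  map_add' k k' := by
    classical
    induction k using Submodule.Quotient.induction_on with | _ q
    induction k' using Submodule.Quotient.induction_on with | _ q'
    change act m (QuotK.mk (q + q')) = act m (QuotK.mk q) + act m (QuotK.mk q')
    -- One representative valid at all three denominators reduces additivity to distributivity in
    -- `Q`.
    rw [act_mk_of_mem m (F := {den q, den q', den (q + q')}) (by simp),
      act_mk_of_mem m (F := {den q, den q', den (q + q')}) (by simp),
      act_mk_of_mem m (F := {den q, den q', den (q + q')}) (by simp), mul_add]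
    rfl
  map_smul' r k := by
    classical
    induction k using Submodule.Quotient.induction_on with | _ q
    change act m (QuotK.mk (r • q)) = r • act m (QuotK.mk q)
    rw [act_mk_of_mem m (F := {den q, den (r • q)}) (by simp),
      act_mk_of_mem m (F := {den q, den (r • q)}) (by simp)]
    exact congrArg QuotK.mk (mul_assoc _ _ _).symm

/-- The canonical embedding of the completion of `R` in `End(K_R)`. -/
noncomputable def toEndK : RCompletion R⁰ R →ₗ[Rᵐᵒᵖ] EndK R where
  toFun := actEnd
  map_add' m m' := by
    refine LinearMap.ext fun k => ?_
    induction k using Submodule.Quotient.induction_on with | _ q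
    obtain ⟨a, s, rfl⟩ := exists_fraction R q
    change act (m + m') (QuotK.mk _) = act m (QuotK.mk _) + act m' (QuotK.mk _)
    rw [act_mk ⟨a, s, rfl, (mkQ_rep m _).symm⟩, act_mk ⟨a, s, rfl, (mkQ_rep m' _).symm⟩,
      act_mk ⟨a, s, rfl, by rw [map_add, ← mkQ_rep m, ← mkQ_rep m', ← map_add]⟩, map_add, add_mul]
    rfl
  map_smul' r m := by
    refine LinearMap.ext fun k => ?_
    induction k using Submodule.Quotient.induction_on with | _ q
    obtain ⟨a, s, rfl⟩ := exists_fraction R q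
    have h₁ : Represents (r • m) (rep m {s} * r.unop) (incl R a * (incl R (s : R))⁻¹) :=
      ⟨a, s, rfl, by rw [map_smul, ← mkQ_rep m, ← map_smul]; rfl⟩
    -- Left multiplication by `r` keeps the denominator `s`, so the same representative of `m`
    -- applies.
    have h₂ : Represents m (rep m {s}) (incl R r.unop * (incl R a * (incl R (s : R))⁻¹)) :=
      ⟨r.unop * a, s, by rw [map_mul, mul_assoc], (mkQ_rep m _).symm⟩
    refine (act_mk h₁).trans (Eq.trans ?_ (act_mk h₂).symm)
    rw [map_mul, mul_assoc]

theorem toEndK_mk {m : RCompletion R⁰ R} {x : R} {q : RightQuot R} (h : Represents m x q) :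
    toEndK m (QuotK.mk q) = QuotK.mk (incl R x * q) :=
  act_mk h

theorem toEndK_eta (x : R) : toEndK (eta R⁰ R x) = EndK.lam R x := by
  refine LinearMap.ext fun k => ?_
  induction k using Submodule.Quotient.induction_on with | _ q
  obtain ⟨a, s, h⟩ := exists_fraction R q
  exact toEndK_mk ⟨a, s, h, proj_eta _ _ _ x⟩

theorem toEndK_injective : Function.Injective (toEndK (R := R)) := by
  rw [injective_iff_map_eq_zero]
  refine fun m hm => ext_proj fun F => ?_
  rw [map_zero, ← mkQ_rep]
  refine (Submodule.Quotient.mk_eq_zero _).mpr (mem_rNhd_iff_singleton.mpr fun s hs => ?_)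
  refine mem_rNhd_singleton_iff.mpr fun r => ?_
  rw [← toEndK_mk (m := m) ⟨r, s, rfl, proj_eq_mkQ_rep m (rNhd_anti (by simpa using hs))⟩, hm]
  rfl

/-! ### The cokernel of `η` -/

/-- The quotient of the completion by the image of `R` is torsion-free. -/
theorem mem_range_eta_of_smul_mem {m : RCompletion R⁰ R} (s : R⁰)
    (h : MulOpposite.op (s : R) • m ∈ LinearMap.range (eta R⁰ R)) :
    m ∈ LinearMap.range (eta R⁰ R) := by
  obtain ⟨x, hx⟩ := h
  have key : ∀ q, toEndK m (QuotK.mk q) = QuotK.mk (incl R x * ((incl R (s : R))⁻¹ * q)) := by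
    intro q
    rw [← EndK.lam_mk, ← toEndK_eta, hx, map_smul, EndK.op_smul_apply, EndK.lam_mk,
      mul_inv_cancel_left₀ (incl_ne_zero s)]
  have h1 := key 1
  rw [show QuotK.mk (1 : RightQuot R) = 0 from QuotK.mk_eq_zero_iff.mpr ⟨1, map_one _⟩, map_zero,
    mul_one] at h1
  obtain ⟨y, hy⟩ := QuotK.mk_eq_zero_iff.mp h1.symm
  refine ⟨y, toEndK_injective (LinearMap.ext fun k => ?_)⟩
  induction k using Submodule.Quotient.induction_on with | _ q
  rw [toEndK_eta]
  change EndK.lam R y (QuotK.mk q) = toEndK m (QuotK.mk q)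
  rw [key, EndK.lam_mk, hy, mul_assoc]

/-- The quotient of the completion by the image of `R` is divisible. -/
theorem exists_smul_add_eta_eq (m : RCompletion R⁰ R) (s : R⁰) :
    ∃ (m' : RCompletion R⁰ R) (y : R), MulOpposite.op (s : R) • m' + eta R⁰ R y = m := by
  classical
  by_cases hbot : ∃ t : R⁰, rNhd R⁰ R {t} = ⊥
  · obtain ⟨t, ht⟩ := hbot
    obtain ⟨y, rfl⟩ := eta_surjective_of_rNhd_eq_bot ht m
    exact ⟨0, y, by rw [smul_zero, zero_add]⟩
  have hu : ∀ t : R⁰, ∃ u : R⁰, (u : R) ∈ rNhd R⁰ R {t} := by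
    intro t
    obtain ⟨u, hu, hu0⟩ := Submodule.exists_mem_ne_zero_of_ne_bot (not_exists.mp hbot t)
    exact ⟨⟨u, mem_nonZeroDivisors_of_ne_zero hu0⟩, hu⟩
  choose u hu using hu
  -- At level `u t * s`, representatives differ by elements of `R u_t s`; cancelling `s` leaves `R
  -- u_t ⊆ U(t)`, which makes the quotients Cauchy.
  let G : Finset R⁰ → Finset R⁰ := fun F => insert s (F ∪ F.image fun t => u t * s)
  have hsG : ∀ F, {s} ⊆ G F := fun F => by simp [G]
  have hFG : ∀ F, F ⊆ G F := fun F t ht => by simp [G, ht]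
  have hGG : ∀ F H, F ⊆ H → G F ⊆ G H := fun F H h =>
    Finset.insert_subset_insert _ (Finset.union_subset_union h (Finset.image_subset_image h))
  have hw : ∀ F, ∃ w, rep m (G F) - rep m {s} = w * s := fun F => by
    simpa using mem_rNhd_iff.mp (rep_sub_rep_mem m (hsG F)) s (by simp) 1
  choose w hw using hw
  have hs0 := nonZeroDivisors.coe_ne_zero s
  have hcauchy : ∀ F H, F ⊆ H → w H - w F ∈ rNhd R⁰ R F := by
    intro F H hFH
    refine mem_rNhd_iff_singleton.mpr fun t ht => ?_
    obtain ⟨n, hn⟩ := mem_rNhd_iff.mp (rep_sub_rep_mem m (hGG F H hFH)) (u t * s)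
      (Finset.mem_insert_of_mem (Finset.mem_union_right _ (Finset.mem_image_of_mem _ ht))) 1
    have : w H - w F = n * u t := by
      refine mul_right_cancel₀ hs0 ?_
      rw [sub_mul, ← hw, ← hw, sub_sub_sub_cancel_right, mul_assoc]
      simpa using hn
    rw [this]
    exact mul_mem_rNhd n (hu t)
  refine ⟨ofCauchy w hcauchy, rep m {s}, ext_proj fun F => ?_⟩
  rw [map_add, map_smul, proj_ofCauchy, proj_eta, ← map_smul, ← map_add,
    proj_eq_mkQ_rep m (rNhd_anti (hFG F))]
  congr 1
  change w F * s + rep m {s} = _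
  rw [← hw, sub_add_cancel]

end RCompletion

/-- A torsion-free divisible right module over a right Ore domain is a direct sum of copies of the
quotient ring `Q`. -/
theorem exists_linearEquiv_finsupp_rightQuot {R : Type*} [Ring R] [IsRightOreDomain R]
    (M : Type u) [AddCommGroup M] [Module Rᵐᵒᵖ M]
    (h : ∀ s : (Rᵐᵒᵖ)⁰, Function.Bijective fun m : M => (s : Rᵐᵒᵖ) • m) :
    ∃ X : Type u, Nonempty (M ≃ₗ[Rᵐᵒᵖ] (X →₀ RightQuot R)) := by
  let f := Module.toAddMonoidEnd Rᵐᵒᵖ M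
  -- Regular scalars act invertibly, so the action extends to the Ore localization, a division ring,
  -- over which `M` has a basis.
  have hf : ∀ s : (Rᵐᵒᵖ)⁰, IsUnit (f s) := fun s => by
    let e := AddEquiv.ofBijective (f s) (h s)
    exact isUnit_iff_exists.mpr ⟨e.symm.toAddMonoidHom,
      AddMonoidHom.ext e.apply_symm_apply, AddMonoidHom.ext e.symm_apply_apply⟩
  let φ := OreLocalization.universalHom f
    (IsUnit.liftRight (f.toMonoidHom.comp (Rᵐᵒᵖ)⁰.subtype) hf) fun _ => rfl
  have hφ : ∀ r, φ (OreLocalization.numeratorHom r) = f r := fun r =>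
    OreLocalization.universalHom_commutes f _ fun _ => rfl
  let _ : Module (OreLocalization (Rᵐᵒᵖ)⁰ Rᵐᵒᵖ) M := Module.compHom M φ
  let b := Module.Basis.ofVectorSpace (OreLocalization (Rᵐᵒᵖ)⁰ Rᵐᵒᵖ) M
  let e : OreLocalization (Rᵐᵒᵖ)⁰ Rᵐᵒᵖ ≃+ RightQuot R := MulOpposite.opAddEquiv
  refine ⟨_, ⟨(b.repr.toAddEquiv.trans (Finsupp.mapRange.addEquiv e)).toLinearEquiv ?_⟩⟩
  intro r m
  have hr : r • m = (OreLocalization.numeratorHom r : OreLocalization (Rᵐᵒᵖ)⁰ Rᵐᵒᵖ) • m :=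
    (DFunLike.congr_fun (hφ r) m).symm
  ext x
  change e (b.repr (r • m) x) = r • e (b.repr m x)
  rw [hr, map_smul]
  rfl

theorem bijective_smul_quotient_range_eta {R : Type*} [Ring R] [IsRightOreDomain R]
    (s : (Rᵐᵒᵖ)⁰) : Function.Bijective
      fun m : RCompletion R⁰ R ⧸ LinearMap.range (eta R⁰ R) => (s : Rᵐᵒᵖ) • m := by
  have hs : (s : Rᵐᵒᵖ).unop ≠ 0 := by simp
  let s' : R⁰ := ⟨(s : Rᵐᵒᵖ).unop, mem_nonZeroDivisors_of_ne_zero hs⟩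
  constructor
  · refine (injective_iff_map_eq_zero
      (DistribSMul.toAddMonoidHom (RCompletion R⁰ R ⧸ LinearMap.range (eta R⁰ R))
        (s : Rᵐᵒᵖ))).mpr fun m hm => ?_
    induction m using Submodule.Quotient.induction_on with | _ m
    exact (Submodule.Quotient.mk_eq_zero _).mpr
      (mem_range_eta_of_smul_mem s' ((Submodule.Quotient.mk_eq_zero _).mp hm))
  · intro m
    induction m using Submodule.Quotient.induction_on with | _ m
    obtain ⟨m', y, h⟩ := exists_smul_add_eta_eq m s'
    refine ⟨Submodule.Quotient.mk m', ?_⟩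
    change Submodule.Quotient.mk ((s : Rᵐᵒᵖ) • m') = _
    rw [eq_comm, Submodule.Quotient.eq]
    exact ⟨y, by rw [← h]; exact (add_sub_cancel_left _ _).symm⟩

theorem isStronglyFlat_rCompletion (R : Type u) [Ring R] [IsRightOreDomain R] :
    IsStronglyFlat R (RCompletion R⁰ R) := by
  intro C hC
  by_cases hR : ∃ a : R, a ≠ 0 ∧ ¬ IsUnit a
  · obtain ⟨X, ⟨e⟩⟩ := exists_linearEquiv_finsupp_rightQuot _
      (bijective_smul_quotient_range_eta (R := R))
    have hfree : Module.Projective Rᵐᵒᵖ R :=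
      .of_equiv (MulOpposite.opLinearEquiv Rᵐᵒᵖ (M := R)).symm
    refine subsingleton_ext_one_of_exact (eta R⁰ R)
      (e.toLinearMap ∘ₗ (LinearMap.range (eta R⁰ R)).mkQ) (eta_injective hR)
      (e.surjective.comp (Submodule.mkQ_surjective _)) (fun m => ?_) C
      (subsingleton_ext_one_finsupp (RightQuot R) X C hC)
    rw [LinearMap.comp_apply, LinearEquiv.coe_coe, map_eq_zero_iff e e.injective,
      Submodule.mkQ_apply, Submodule.Quotient.mk_eq_zero]
    rfl
  · push Not at hR
    have := subsingleton_rCompletion hR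
    exact CategoryTheory.Abelian.Ext.subsingleton_of_projective
      (ModuleCat.of Rᵐᵒᵖ (RCompletion R⁰ R)) C 0

theorem theorem4p9 (R : Type u) [Ring R] [IsRightOreDomain R] :
    -- the completion of `R` is a strongly flat right module
    IsStronglyFlat R (RCompletion R⁰ R) ∧
    -- `R` embeds in its completion, unless it is a division ring
    ((∃ a : R, a ≠ 0 ∧ ¬ IsUnit a) → Function.Injective (RCompletion.eta R⁰ R)) ∧
    -- the canonical embedding of the completion in `End(K_R)`
    (∃ L : RCompletion R⁰ R →ₗ[Rᵐᵒᵖ] EndK R,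
      Function.Injective L ∧
      (∀ x : R, L (RCompletion.eta R⁰ R x) = EndK.lam R x) ∧
      (∀ (m : RCompletion R⁰ R) (s : R⁰) (x r : R),
        RCompletion.proj R⁰ R {s} m = (rNhd R⁰ R {s}).mkQ x →
          L m (QuotK.mk (RightQuot.incl R r * (RightQuot.incl R (s : R))⁻¹)) =
            QuotK.mk (RightQuot.incl R x *
              (RightQuot.incl R r * (RightQuot.incl R (s : R))⁻¹)))) ∧
    -- the quotient is a direct sum of copies of `Q`
    (∃ X : Type u, Nonempty
      ((RCompletion R⁰ R ⧸ LinearMap.range (RCompletion.eta R⁰ R)) ≃ₗ[Rᵐᵒᵖ]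
        (X →₀ RightQuot R))) :=
  ⟨isStronglyFlat_rCompletion R, eta_injective,
    ⟨toEndK, toEndK_injective, toEndK_eta, fun _ s _ r h => toEndK_mk ⟨r, s, rfl, h⟩⟩,
    exists_linearEquiv_finsupp_rightQuot _ bijective_smul_quotient_range_eta⟩
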